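/- A deck of $n$ cards numbered $1,\dots,n$ is laid out in a row in increasing order from left to right. In the card-cyclic to random insertion shuffle, the cards $1,2,\dots,n$ are, in this order, each removed from the row and reinserted exactly once, every time at a position chosen uniformly at random among the $n$ possible positions, independently of the previous choices. Let $p_n(\mathrm{id},\cdot)$ be the distribution on $S_n$ of the resulting deck $\sigma$, where $\sigma_j$ is the number of the card in position $j$ from the left, and let $E^{p_n(\mathrm{id},\cdot)}\sigma^{-1}_{j}$ be the expected final position of card number $j$. Let $b\in[0,1]$. For all card numbers $1\le b_nn\le n$ with $\lim_{n\to\infty}b_n=b$, the limit $E(b)\equiv\lim_{n\to\infty}\frac1nE^{p_n(\mathrm{id},\cdot)}\sigma^{-1}_{b_nn}$ exists, depends only on $b$, and equals $$E(b)=eb+\tfrac12e^{1-b}-e^b .$$ The function $E:[0,1]\to\mathbb R$ has the following properties (where $\approx$ means rounded to three decimals). i. $E(0)=\frac12e-1\approx .359$. ii. $E(1)=\frac12$. iii. $E$ is strictly increasing on $[0,b^*]$ and strictly decreasing on $[b^*,1]$, where $b^*\approx .722$ is the unique solution in $[0,1]$ of $e-e^b-\frac12e^{1-b}=0$; hence $E$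 attains its maximum only at $b^*$, and $E(b^*)\approx .564$. iv. There is $\bar b\approx .545$ in $(0,1)$ such that $E(b)>b$ for $b\in[0,\bar b)$, $E(\bar b)=\bar b$, and $E(b)<b$ for $b\in(\bar b,1]$. v. $\int_0^1E(b)\,db=\frac12$. -/

import Mathlib

open Filter Topology Set

namespace CardCyclic

/- A deck of `n` cards is a permutation `σ : Equiv.Perm (Fin n)`: `σ j` is the card in position `j`
from the left, and `σ.symm c` is the position of card `c`. Cards and positions are indexed from
`0`, so that the card with index `c : Fin n` carries the number `c + 1`, and the index `j : Fin n`
stands for the `(j + 1)`-st position. -/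

/-- Remove card `c` from the deck `σ` and reinsert it so that it ends up in position `k`, the
other cards keeping their order. The second clause says: position `k` of the new deck holds `c`, and
position `k.succAbove j` (the `j`-th one among those different from `k`) holds the `j`-th card of
the deck that remains when `c` is removed; see the two lemmas below. -/
def moveCard : {n : ℕ} → Equiv.Perm (Fin n) → Fin n → Fin n → Equiv.Perm (Fin n)
  | 0, σ, _, _ => σ
  | _ + 1, σ, c, k => ((finSuccEquiv' k).trans (finSuccEquiv' (σ.symm c)).symm).trans σ

theorem moveCard_apply_self {n : ℕ} (σ : Equiv.Perm (Fin (n + 1))) (c k : Fin (n + 1)) :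
    moveCard σ c k k = c := by
  simp [moveCard]

theorem moveCard_apply_succAbove {n : ℕ} (σ : Equiv.Perm (Fin (n + 1))) (c k : Fin (n + 1))
    (j : Fin n) : moveCard σ c k (k.succAbove j) = σ ((σ.symm c).succAbove j) := by
  simp [moveCard]

/-- The outcome of the shuffle started from the deck `σ`: the cards `σ 0, σ 1, …`, in their
original left to right order, are each removed and reinserted exactly once, the `t`-th one into
position `u t`. -/
def shuffle {n : ℕ} (σ : Equiv.Perm (Fin n)) (u : Fin n → Fin n) : Equiv.Perm (Fin n) :=
  (List.finRange n).foldl (fun τ t => moveCard τ (σ t) (u t)) σ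

/-- The transition probability `p_n(σ, τ)` of the card-cyclic to random insertion shuffle: the
`n ^ n` choices of the reinsertion positions are equally likely. -/
noncomputable def transProb {n : ℕ} (σ τ : Equiv.Perm (Fin n)) : ℝ :=
  ((Finset.univ.filter fun u : Fin n → Fin n => shuffle σ u = τ).card : ℝ) / (n : ℝ) ^ n

/-- The expected final position (counted from `1`) of card `c` when the shuffle starts from the
identity deck, that is, the expectation of `τ⁻¹(c)` under `p_n(id, ·)`. -/
noncomputable def meanPosition {n : ℕ} (c : Fin n) : ℝ :=
  ∑ τ : Equiv.Perm (Fin n), transProb 1 τ * (((τ.symm c : ℕ) : ℝ) + 1)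

/-- `x` is the rescaled limiting mean position of a card with a number around `b n`: whenever card
number `j_n` of a deck of `n` cards is chosen, for every `n ≥ 1`, such that `j_n / n → b`, its
expected final position divided by `n` converges to `x`. (The deck of `n + 1` cards is the `n`-th
one, and `j_{n + 1} = c n + 1`.) -/
def IsLimitingMean (b x : ℝ) : Prop :=
  ∀ c : (n : ℕ) → Fin (n + 1),
    Tendsto (fun n : ℕ => (((c n : ℕ) : ℝ) + 1) / ((n : ℝ) + 1)) atTop (𝓝 b) →
    Tendsto (fun n : ℕ => meanPosition (c n) / ((n : ℝ) + 1)) atTop (𝓝 x)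

end CardCyclic

/-! Write n = m + 1, q = 1 + 1/n, and count positions from 0. Reinserting card c preserves the rank
of any other card d among the cards other than c, and shifts d by one if the insertion lands at or
before that rank; orders not involving c are unchanged. Hence mean positions and precedence
probabilities obey closed linear recursions in the number of moves. An unmoved card has the card
about to move surely on its left (`partialMean_position_unmoved`); this yields the precedence
probabilities (`partialMean_precedes_moved`), then the mean position of a moved card
(`partialMean_position_moved`). After n moves this is `meanPosition_eq`, and q^k tends to e^b when
k/n tends to b.

For the shape of E, put x = e^b. Then x E'(b) is a quadratic in x with one root below 1 and the
other at b = b*, while x (E'(b) - 1) is a quadratic of negative discriminant, so E(b) - b decreases.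
Rational bounds on exponentials locate b* and the fixed point. -/

namespace CardCyclic

/-- Averaging over the uniform reinsertion position of card `c`. -/
noncomputable def insertionMean {m : ℕ} (c : Fin (m + 1)) (F : Equiv.Perm (Fin (m + 1)) → ℝ)
    (τ : Equiv.Perm (Fin (m + 1))) : ℝ :=
  (∑ k, F (moveCard τ c k)) / ((m : ℝ) + 1)

/-- Expectation of `F` after the cards `0, …, t - 1` have been moved, started from the identity. -/
noncomputable def partialMean {m : ℕ} : (t : ℕ) → (Equiv.Perm (Fin (m + 1)) → ℝ) → ℝ
  | 0, F => F 1
  | t + 1, F => partialMean t (insertionMean (Fin.ofNat (m + 1) t) F)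

/-- The position of card `d`, as a real observable. -/
def position {m : ℕ} (d : Fin (m + 1)) (τ : Equiv.Perm (Fin (m + 1))) : ℝ :=
  ((τ.symm d : ℕ) : ℝ)

/-- The indicator that card `a` lies to the left of card `b`. -/
noncomputable def precedes {m : ℕ} (a b : Fin (m + 1)) (τ : Equiv.Perm (Fin (m + 1))) : ℝ :=
  if τ.symm a < τ.symm b then 1 else 0

/-! ### Effect of one reinsertion on positions and relative orders -/

section Moves

variable {m : ℕ}

theorem moveCard_symm_self (σ : Equiv.Perm (Fin (m + 1))) (c k : Fin (m + 1)) :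
    (moveCard σ c k).symm c = k := by
  rw [Equiv.symm_apply_eq, moveCard_apply_self]

theorem moveCard_symm_of_succAbove (σ : Equiv.Perm (Fin (m + 1))) (c k d : Fin (m + 1))
    (j : Fin m) (hj : (σ.symm c).succAbove j = σ.symm d) :
    (moveCard σ c k).symm d = k.succAbove j := by
  rw [Equiv.symm_apply_eq, moveCard_apply_succAbove, hj, Equiv.apply_symm_apply]

theorem exists_succAbove_eq_symm (σ : Equiv.Perm (Fin (m + 1))) {c d : Fin (m + 1)} (h : d ≠ c) :
    ∃ j : Fin m, (σ.symm c).succAbove j = σ.symm d :=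
  Fin.exists_succAbove_eq (fun e => h (σ.symm.injective e))

theorem val_succAbove (k : Fin (m + 1)) (j : Fin m) :
    ((k.succAbove j : ℕ) : ℝ) = (j : ℕ) + if k ≤ j.castSucc then 1 else 0 := by
  by_cases h : k ≤ j.castSucc
  · simp [Fin.succAbove_of_le_castSucc _ _ h, h]
  · simp [Fin.succAbove_of_castSucc_lt _ _ (not_le.mp h), h]

theorem lt_succAbove_iff (k : Fin (m + 1)) (j : Fin m) :
    k < k.succAbove j ↔ k ≤ j.castSucc := by
  rw [Fin.lt_succAbove_iff_le_castSucc]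

/-- Deleting c lowers the position of d by one exactly when c is to its left; j is the rank that
reinsertion preserves. -/
theorem position_sub_precedes (σ : Equiv.Perm (Fin (m + 1))) (c d : Fin (m + 1)) (j : Fin m)
    (hj : (σ.symm c).succAbove j = σ.symm d) :
    position d σ - precedes c d σ = (j : ℕ) := by
  simp only [position, precedes, ← hj, val_succAbove, lt_succAbove_iff]
  ring

theorem sum_ite_le_castSucc (j : Fin m) :
    ∑ k : Fin (m + 1), (if k ≤ j.castSucc then (1 : ℝ) else 0) = (j : ℕ) + 1 := by
  rw [Finset.sum_boole]
  have : (Finset.univ.filter fun k : Fin (m + 1) => k ≤ j.castSucc) = Finset.Iic j.castSucc := by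
    ext; simp
  rw [this, Fin.card_Iic]
  simp

theorem insertionMean_position_self (c : Fin (m + 1)) :
    insertionMean c (position c) = fun _ => (m : ℝ) / 2 := by
  funext τ
  have h : ∑ k : Fin (m + 1), ((k : ℕ) : ℝ) = (m + 1) * m / 2 := by
    rw [Fin.sum_univ_eq_sum_range (fun i => (i : ℝ)), eq_div_iff (by norm_num)]
    have := Finset.sum_range_id_mul_two (m + 1)
    rw [Nat.add_sub_cancel] at this
    have := congrArg (Nat.cast : ℕ → ℝ) this
    push_cast at this
    exact this
  simp only [insertionMean, position, moveCard_symm_self, h]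
  field_simp

/-- The rank j becomes j + 1 for j + 1 of the n insertion positions and stays j for the others. -/
theorem insertionMean_position {c d : Fin (m + 1)} (h : d ≠ c) :
    insertionMean c (position d) = fun τ =>
      (position d τ - precedes c d τ) * (1 + 1 / ((m : ℝ) + 1)) + 1 / ((m : ℝ) + 1) := by
  funext τ
  obtain ⟨j, hj⟩ := exists_succAbove_eq_symm τ h
  rw [position_sub_precedes τ c d j hj]
  simp only [insertionMean, position, moveCard_symm_of_succAbove τ c _ d j hj, val_succAbove,
    Finset.sum_add_distrib, sum_ite_le_castSucc]
  simp
  field_simp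
  ring

theorem insertionMean_precedes_self {c d : Fin (m + 1)} (h : d ≠ c) :
    insertionMean c (precedes d c) = fun τ =>
      ((m : ℝ) - (position d τ - precedes c d τ)) / ((m : ℝ) + 1) := by
  funext τ
  obtain ⟨j, hj⟩ := exists_succAbove_eq_symm τ h
  rw [position_sub_precedes τ c d j hj]
  have key : ∀ k : Fin (m + 1), (if k.succAbove j < k then (1 : ℝ) else 0) =
      1 - if k ≤ j.castSucc then 1 else 0 := by
    intro k
    by_cases hk : k ≤ j.castSucc
    · simp [Fin.succAbove_lt_iff_castSucc_lt, hk]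
    · simp [Fin.succAbove_lt_iff_castSucc_lt, hk, not_le.mp hk]
  simp only [insertionMean, precedes, moveCard_symm_of_succAbove τ c _ d j hj, moveCard_symm_self,
    key, Finset.sum_sub_distrib, sum_ite_le_castSucc]
  simp

theorem insertionMean_precedes {a b c : Fin (m + 1)} (ha : a ≠ c) (hb : b ≠ c) :
    insertionMean c (precedes a b) = precedes a b := by
  funext τ
  obtain ⟨i, hi⟩ := exists_succAbove_eq_symm τ ha
  obtain ⟨j, hj⟩ := exists_succAbove_eq_symm τ hb
  simp only [insertionMean, precedes, moveCard_symm_of_succAbove τ c _ a i hi,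
    moveCard_symm_of_succAbove τ c _ b j hj, ← hi, ← hj, Fin.succAbove_lt_succAbove_iff,
    Finset.sum_const, Finset.card_univ, Fintype.card_fin, nsmul_eq_mul]
  push_cast
  rw [mul_div_cancel_left₀ _ (by positivity)]

theorem insertionMean_affine (c : Fin (m + 1)) (F G : Equiv.Perm (Fin (m + 1)) → ℝ) (x y z : ℝ) :
    insertionMean c (fun τ => x * F τ + y * G τ + z) =
      fun τ => x * insertionMean c F τ + y * insertionMean c G τ + z := by
  funext τ
  simp only [insertionMean, Finset.sum_add_distrib, ← Finset.mul_sum]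
  simp
  field_simp

theorem partialMean_affine (t : ℕ) (F G : Equiv.Perm (Fin (m + 1)) → ℝ) (x y z : ℝ) :
    partialMean t (fun τ => x * F τ + y * G τ + z) =
      x * partialMean t F + y * partialMean t G + z := by
  induction t generalizing F G with
  | zero => rfl
  | succ t ih => simp only [partialMean, insertionMean_affine, ih]

theorem partialMean_const (t : ℕ) (z : ℝ) :
    partialMean t (fun _ : Equiv.Perm (Fin (m + 1)) => z) = z := by
  simpa using partialMean_affine t (fun _ : Equiv.Perm (Fin (m + 1)) => 0) (fun _ => 0) 0 0 z

/-! ### Recursions in the number of moves -/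

theorem ne_ofNat_of_lt {d : Fin (m + 1)} {t : ℕ} (h : t < d) : d ≠ Fin.ofNat (m + 1) t := by
  rintro rfl
  exact absurd h (by simpa using Nat.mod_le t (m + 1))

theorem ne_ofNat_of_gt {c : Fin (m + 1)} {t : ℕ} (ht : t < m + 1) (h : (c : ℕ) < t) :
    c ≠ Fin.ofNat (m + 1) t := by
  rintro rfl
  simp [Nat.mod_eq_of_lt ht] at h

theorem partialMean_precedes_unmoved {a b : Fin (m + 1)} (hab : a < b) (t : ℕ) (ht : t ≤ a) :
    partialMean t (precedes a b) = 1 := by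
  induction t with
  | zero => exact if_pos hab
  | succ t ih =>
    have h1 : a ≠ Fin.ofNat (m + 1) t := ne_ofNat_of_lt ht
    have h2 : b ≠ Fin.ofNat (m + 1) t := ne_ofNat_of_lt (lt_trans ht hab)
    rw [partialMean, insertionMean_precedes h1 h2, ih (by omega)]

theorem partialMean_succ_position {d : Fin (m + 1)} {t : ℕ} (h : d ≠ Fin.ofNat (m + 1) t) :
    partialMean (t + 1) (position d) =
      (partialMean t (position d) - partialMean t (precedes (Fin.ofNat (m + 1) t) d)) *
        (1 + 1 / ((m : ℝ) + 1)) + 1 / ((m : ℝ) + 1) := by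
  have := partialMean_affine t (position d) (precedes (Fin.ofNat (m + 1) t) d)
    (1 + 1 / ((m : ℝ) + 1)) (-(1 + 1 / ((m : ℝ) + 1))) (1 / ((m : ℝ) + 1))
  rw [partialMean, insertionMean_position h]
  rw [show (fun τ => (position d τ - precedes (Fin.ofNat (m + 1) t) d τ) *
    (1 + 1 / ((m : ℝ) + 1)) + 1 / ((m : ℝ) + 1)) = fun τ => (1 + 1 / ((m : ℝ) + 1)) * position d τ
      + (-(1 + 1 / ((m : ℝ) + 1))) * precedes (Fin.ofNat (m + 1) t) d τ + 1 / ((m : ℝ) + 1) by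
    funext τ; ring, this]
  ring

/-- Card t, itself still unmoved, is surely left of d, so the mean follows x ↦ q x - 1, whose fixed
point is n. -/
theorem partialMean_position_unmoved (d : Fin (m + 1)) (t : ℕ) (ht : t ≤ d) :
    partialMean t (position d) =
      (m + 1) + ((d : ℕ) - ((m : ℝ) + 1)) * (1 + 1 / ((m : ℝ) + 1)) ^ t := by
  induction t with
  | zero => simp [partialMean, position, Equiv.Perm.one_def]
  | succ t ih =>
    have hlt : Fin.ofNat (m + 1) t < d := by
      rw [Fin.lt_def]; exact lt_of_le_of_lt (by simpa using Nat.mod_le t (m + 1)) ht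
    have hv : t ≤ (Fin.ofNat (m + 1) t : ℕ) := by
      simp [Nat.mod_eq_of_lt (show t < m + 1 by omega)]
    rw [partialMean_succ_position (ne_ofNat_of_lt ht), ih (by omega),
      partialMean_precedes_unmoved hlt t hv, pow_succ]
    field_simp
    ring

/-- The probability that the unmoved card `d` lies to the left of the moved card `c`. -/
theorem partialMean_precedes_moved {c d : Fin (m + 1)} (t : ℕ) (hc : (c : ℕ) + 1 ≤ t)
    (ht : t ≤ d) :
    partialMean t (precedes d c) =
      (1 - (d : ℕ) / ((m : ℝ) + 1)) * (1 + 1 / ((m : ℝ) + 1)) ^ (c : ℕ) := by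
  induction t, hc using Nat.le_induction with
  | base =>
    have hofc : Fin.ofNat (m + 1) (c : ℕ) = c := by simp
    have hcd : c < d := by rw [Fin.lt_def]; omega
    rw [partialMean, hofc, insertionMean_precedes_self hcd.ne',
      show (fun τ => ((m : ℝ) - (position d τ - precedes c d τ)) / ((m : ℝ) + 1)) = fun τ =>
        (-1 / ((m : ℝ) + 1)) * position d τ + (1 / ((m : ℝ) + 1)) * precedes c d τ
          + m / ((m : ℝ) + 1) by funext τ; ring,
      partialMean_affine, partialMean_position_unmoved d c hcd.le,
      partialMean_precedes_unmoved hcd c le_rfl]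
    field_simp
    ring
  | succ t hct ih =>
    -- The cards moved after c and before d leave the order of c and d alone.
    rw [partialMean, insertionMean_precedes (ne_ofNat_of_lt ht)
      (ne_ofNat_of_gt (by omega) (by omega)), ih (by omega)]

/-- The recursion is y ↦ q y - q^(c+1) (1 - t/n) + 1/n, with particular solution -q^(c+1) t - 1. The
multiple of q^t is fitted to the value m/2 right after the uniform insertion of c. -/
theorem partialMean_position_moved (c : Fin (m + 1)) (t : ℕ) (hc : (c : ℕ) + 1 ≤ t)
    (ht : t ≤ m + 1) :
    partialMean t (position c) =
      -(1 + 1 / ((m : ℝ) + 1)) ^ ((c : ℕ) + 1) * t - 1 +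
        ((c : ℕ) + 1) * (1 + 1 / ((m : ℝ) + 1)) ^ t +
          (m + 2) / 2 * (1 + 1 / ((m : ℝ) + 1)) ^ (t - ((c : ℕ) + 1)) := by
  induction t, hc using Nat.le_induction with
  | base =>
    have hofc : Fin.ofNat (m + 1) (c : ℕ) = c := by simp
    rw [partialMean, hofc, insertionMean_position_self, partialMean_const]
    push_cast
    simp
    ring
  | succ t hct ih =>
    have hv : (Fin.ofNat (m + 1) t : ℕ) = t := by simp [Nat.mod_eq_of_lt (show t < m + 1 by omega)]
    rw [partialMean_succ_position (ne_ofNat_of_gt (by omega) (by omega)), ih (by omega),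
      partialMean_precedes_moved t hct hv.ge, hv, Nat.succ_sub hct, pow_succ, pow_succ, pow_succ]
    push_cast
    field_simp
    ring

theorem sum_foldl_moveCard (F : Equiv.Perm (Fin (m + 1)) → ℝ) (t : ℕ) :
    (∑ u : Fin t → Fin (m + 1), F ((List.finRange t).foldl
      (fun τ (i : Fin _) => moveCard τ (Fin.ofNat (m + 1) i) (u i)) 1)) =
        ((m : ℝ) + 1) ^ t * partialMean t F := by
  induction t generalizing F with
  | zero => simp [partialMean]
  | succ t ih =>
    -- Splitting off the last choice matches `partialMean`, which averages over the last move first.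
    rw [partialMean, pow_succ, mul_right_comm, ← ih, Finset.sum_mul,
      ← (Fin.snocEquiv (fun _ => Fin (m + 1))).sum_comp, Fintype.sum_prod_type_right]
    refine Finset.sum_congr rfl fun u _ => ?_
    simp [insertionMean, List.finRange_succ_last, List.foldl_map, Fin.snocEquiv]
    field_simp

theorem meanPosition_eq_partialMean (c : Fin (m + 1)) :
    meanPosition c = partialMean (m + 1) (position c) + 1 := by
  have h := sum_foldl_moveCard (fun τ => position c τ + 1) (m + 1)
  have h1 := partialMean_affine (m + 1) (position c) (position c) 1 0 1
  simp only [one_mul, zero_mul, add_zero] at h1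
  rw [h1] at h
  have h2 : meanPosition c = (∑ u : Fin (m + 1) → Fin (m + 1),
      (position c (shuffle 1 u) + 1)) / ((m : ℝ) + 1) ^ (m + 1) := by
    rw [← Finset.sum_fiberwise (s := Finset.univ) (g := fun u => shuffle 1 u), Finset.sum_div]
    refine Finset.sum_congr rfl fun τ _ => ?_
    rw [Finset.sum_congr rfl (g := fun _ => position c τ + 1)
      (fun u hu => by rw [(Finset.mem_filter.mp hu).2])]
    simp only [transProb, Finset.sum_const, nsmul_eq_mul, position]
    push_cast
    ring
  have h3 : ∀ u : Fin (m + 1) → Fin (m + 1), shuffle 1 u = (List.finRange (m + 1)).foldl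
      (fun τ (i : Fin _) => moveCard τ (Fin.ofNat (m + 1) i) (u i)) 1 := by
    intro u
    simp [shuffle]
  rw [h2, Finset.sum_congr rfl (fun u _ => by rw [h3 u]), h]
  field_simp

/-- The exact expected final position of card `c` in a deck of `m + 1` cards. -/
theorem meanPosition_eq (c : Fin (m + 1)) :
    meanPosition c = ((c : ℕ) + 1) * (1 + 1 / ((m : ℝ) + 1)) ^ (m + 1) +
      (m + 2) / 2 * (1 + 1 / ((m : ℝ) + 1)) ^ (m - (c : ℕ)) -
        (m + 1) * (1 + 1 / ((m : ℝ) + 1)) ^ ((c : ℕ) + 1) := by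
  rw [meanPosition_eq_partialMean, partialMean_position_moved c (m + 1) (by omega) le_rfl,
    Nat.add_sub_add_right]
  push_cast
  ring

end Moves

/-! ### Passage to the limit -/

theorem tendsto_one_add_div_pow {k : ℕ → ℕ} {b : ℝ}
    (hk : Tendsto (fun n : ℕ => (k n : ℝ) / ((n : ℝ) + 1)) atTop (𝓝 b)) :
    Tendsto (fun n : ℕ => (1 + 1 / ((n : ℝ) + 1)) ^ k n) atTop (𝓝 (Real.exp b)) := by
  have h0 : Tendsto (fun n : ℕ => (n : ℝ) + 1) atTop atTop :=
    tendsto_atTop_add_const_right _ _ tendsto_natCast_atTop_atTop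
  -- q^k = exp((k/n) · n log(1 + 1/n)), and n log(1 + 1/n) → 1.
  have h1 := (Real.tendsto_mul_log_one_add_div_atTop 1).comp h0
  have h2 := (Real.continuous_exp.tendsto _).comp (hk.mul h1)
  rw [mul_one] at h2
  refine h2.congr fun n => ?_
  have hp : (0 : ℝ) < 1 + 1 / ((n : ℝ) + 1) := by positivity
  have hn : ((n : ℝ) + 1) ≠ 0 := by positivity
  simp only [Function.comp_apply]
  rw [← mul_assoc, div_mul_cancel₀ _ hn, Real.exp_nat_mul, Real.exp_log hp]

theorem isLimitingMean (b : ℝ) :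
    IsLimitingMean b (Real.exp 1 * b + 1 / 2 * Real.exp (1 - b) - Real.exp b) := by
  intro c hc
  have hn : ∀ n : ℕ, ((n : ℝ) + 1) ≠ 0 := fun n => by positivity
  have h1 : Tendsto (fun n : ℕ => (1 + 1 / ((n : ℝ) + 1)) ^ (n + 1)) atTop (𝓝 (Real.exp 1)) := by
    apply tendsto_one_add_div_pow
    refine tendsto_const_nhds.congr fun n => ?_
    push_cast
    rw [div_self (hn n)]
  have h2 : Tendsto (fun n : ℕ => (1 + 1 / ((n : ℝ) + 1)) ^ ((c n : ℕ) + 1)) atTop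
      (𝓝 (Real.exp b)) := by
    apply tendsto_one_add_div_pow
    simpa using hc
  have h3 : Tendsto (fun n : ℕ => (1 + 1 / ((n : ℝ) + 1)) ^ (n - (c n : ℕ))) atTop
      (𝓝 (Real.exp (1 - b))) := by
    apply tendsto_one_add_div_pow
    refine (hc.const_sub 1).congr fun n => ?_
    rw [Nat.cast_sub (by omega)]
    have := hn n
    field_simp
    ring
  have h4 : Tendsto (fun n : ℕ => 1 / 2 * (1 + 1 / ((n : ℝ) + 1))) atTop (𝓝 (1 / 2)) := by
    simpa using (tendsto_one_div_add_atTop_nhds_zero_nat.const_add (1 : ℝ)).const_mul (1 / 2 : ℝ)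
  refine (((h1.mul hc).add (h4.mul h3)).sub h2).congr fun n => ?_
  rw [meanPosition_eq]
  have := hn n
  field_simp
  ring

end CardCyclic

/-! ### Calculus of the limit function -/

namespace CardCyclic

open Real

/-- The limiting rescaled mean position of a card whose rescaled number is `b`. -/
noncomputable def limitMean (b : ℝ) : ℝ :=
  exp 1 * b + 1 / 2 * exp (1 - b) - exp b

/-- The derivative of `limitMean`. -/
noncomputable def limitMeanSlope (b : ℝ) : ℝ :=
  exp 1 - exp b - 1 / 2 * exp (1 - b)

theorem hasDerivAt_limitMean (b : ℝ) : HasDerivAt limitMean (limitMeanSlope b) b := by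
  have h1 := (hasDerivAt_id b).const_mul (exp 1)
  have h2 := (((hasDerivAt_id b).const_sub 1).exp).const_mul (1 / 2 : ℝ)
  refine ((h1.add h2).sub (hasDerivAt_exp b)).congr_deriv ?_
  simp [limitMeanSlope]
  ring

theorem continuous_limitMean : Continuous limitMean := by
  unfold limitMean; fun_prop

theorem continuous_limitMeanSlope : Continuous limitMeanSlope := by
  unfold limitMeanSlope; fun_prop

theorem exp_mem_Icc_of_taylor {x l u : ℝ} (h0 : 0 ≤ x) (h1 : x ≤ 1)
    (hl : l ≤ ∑ i ∈ Finset.range 11, x ^ i / (i.factorial : ℝ))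
    (hu : (∑ i ∈ Finset.range 11, x ^ i / (i.factorial : ℝ)) +
      x ^ 11 * ((11 : ℕ) + 1) / (((11 : ℕ).factorial : ℝ) * (11 : ℕ)) ≤ u) :
    exp x ∈ Icc l u :=
  ⟨hl.trans (sum_le_exp_of_nonneg h0 11), (exp_bound' h0 h1 (by norm_num)).trans hu⟩

/-- The points 0.72163 and 0.72164 enclose b*; the bounds also serve to approximate E(b*). -/
theorem exp_left_bracket : exp 0.72163 ∈ Icc (2.0577842 : ℝ) 2.0577847 := by
  apply exp_mem_Icc_of_taylor <;> norm_num [Finset.sum_range_succ, Nat.factorial]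

theorem exp_right_bracket : exp 0.72164 ∈ Icc (2.0578048 : ℝ) 2.0578053 := by
  apply exp_mem_Icc_of_taylor <;> norm_num [Finset.sum_range_succ, Nat.factorial]

/-- The points 0.5446 and 0.5454 enclose the fixed point and lie within .0005 of .545. -/
theorem exp_lower_fixed : exp 0.5446 ∈ Icc (1.72391 : ℝ) 1.72392 := by
  apply exp_mem_Icc_of_taylor <;> norm_num [Finset.sum_range_succ, Nat.factorial]

theorem exp_upper_fixed : exp 0.5454 ∈ Icc (1.72529 : ℝ) 1.7253 := by
  apply exp_mem_Icc_of_taylor <;> norm_num [Finset.sum_range_succ, Nat.factorial]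

theorem exp_mul_limitMeanSlope (b : ℝ) :
    exp b * limitMeanSlope b = -(exp b ^ 2 - exp 1 * exp b + exp 1 / 2) := by
  have : exp b * exp (1 - b) = exp 1 := by rw [← exp_add]; ring_nf
  unfold limitMeanSlope
  linear_combination (-1 / 2) * this

theorem exp_mul_limitMean (b : ℝ) :
    exp b * limitMean b = exp 1 * b * exp b + exp 1 / 2 - exp b ^ 2 := by
  have : exp b * exp (1 - b) = exp 1 := by rw [← exp_add]; ring_nf
  unfold limitMean
  linear_combination (1 / 2) * this

theorem exists_limitMeanSlope_eq_zero :
    ∃ s ∈ Icc (0.72163 : ℝ) 0.72164, limitMeanSlope s = 0 := by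
  have h1 : 0 ≤ limitMeanSlope 0.72163 := by
    refine nonneg_of_mul_nonneg_right ?_ (exp_pos 0.72163)
    rw [exp_mul_limitMeanSlope]
    obtain ⟨hl, hu⟩ := exp_left_bracket
    nlinarith [exp_one_gt_d9, exp_one_lt_d9]
  have h2 : limitMeanSlope 0.72164 ≤ 0 := by
    refine nonpos_of_mul_nonpos_right ?_ (exp_pos 0.72164)
    rw [exp_mul_limitMeanSlope]
    obtain ⟨hl, hu⟩ := exp_right_bracket
    nlinarith [exp_one_gt_d9, exp_one_lt_d9]
  exact intermediate_value_Icc' (by norm_num) continuous_limitMeanSlope.continuousOn ⟨h2, h1⟩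

section CriticalPoint

variable {s : ℝ}

theorem exp_critical_mem (hs : s ∈ Icc (0.72163 : ℝ) 0.72164) :
    exp s ∈ Icc (2.0577842 : ℝ) 2.0578053 :=
  ⟨exp_left_bracket.1.trans (exp_le_exp.2 hs.1), (exp_le_exp.2 hs.2).trans exp_right_bracket.2⟩

/-- By Vieta, the quadratic x² - e x + e/2 with root e^s has e - e^s as its other root. -/
theorem exp_mul_limitMeanSlope_eq (h0 : limitMeanSlope s = 0) (b : ℝ) :
    exp b * limitMeanSlope b = (exp s - exp b) * (exp b + exp s - exp 1) := by
  have h1 := exp_mul_limitMeanSlope s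
  rw [h0, mul_zero] at h1
  rw [exp_mul_limitMeanSlope]
  linear_combination -h1

/-- The second root e - e^s is about .66, below 1 ≤ e^b, so it gives no critical point with b ≥ 0.
-/
theorem exp_add_exp_critical_sub_pos (hs : s ∈ Icc (0.72163 : ℝ) 0.72164) {b : ℝ} (hb : 0 ≤ b) :
    0 < exp b + exp s - exp 1 := by
  have := (exp_critical_mem hs).1
  have := exp_one_lt_d9
  have := one_le_exp hb
  linarith

theorem limitMeanSlope_eq_zero_iff (hs : s ∈ Icc (0.72163 : ℝ) 0.72164)
    (h0 : limitMeanSlope s = 0) {b : ℝ} (hb : 0 ≤ b) : limitMeanSlope b = 0 ↔ b = s := by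
  refine ⟨fun h => ?_, fun h => h ▸ h0⟩
  have h1 := exp_mul_limitMeanSlope_eq h0 b
  rw [h, mul_zero, eq_comm, mul_eq_zero] at h1
  have h2 := h1.resolve_right (exp_add_exp_critical_sub_pos hs hb).ne'
  exact (exp_injective (sub_eq_zero.1 h2)).symm

theorem strictMonoOn_limitMean (hs : s ∈ Icc (0.72163 : ℝ) 0.72164)
    (h0 : limitMeanSlope s = 0) : StrictMonoOn limitMean (Icc 0 s) := by
  refine strictMonoOn_of_deriv_pos (convex_Icc _ _) continuous_limitMean.continuousOn fun b hb => ?_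
  rw [interior_Icc] at hb
  rw [(hasDerivAt_limitMean b).deriv]
  refine pos_of_mul_pos_right ?_ (exp_pos b).le
  rw [exp_mul_limitMeanSlope_eq h0]
  exact mul_pos (sub_pos.2 (exp_lt_exp.2 hb.2)) (exp_add_exp_critical_sub_pos hs hb.1.le)

theorem strictAntiOn_limitMean (hs : s ∈ Icc (0.72163 : ℝ) 0.72164)
    (h0 : limitMeanSlope s = 0) : StrictAntiOn limitMean (Icc s 1) := by
  refine strictAntiOn_of_deriv_neg (convex_Icc _ _) continuous_limitMean.continuousOn fun b hb => ?_
  rw [interior_Icc] at hb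
  rw [(hasDerivAt_limitMean b).deriv]
  refine neg_of_mul_neg_right ?_ (exp_pos b).le
  rw [exp_mul_limitMeanSlope_eq h0]
  have h1 : 0 ≤ b := by linarith [hs.1, hb.1]
  exact mul_neg_of_neg_of_pos (sub_neg.2 (exp_lt_exp.2 hb.1)) (exp_add_exp_critical_sub_pos hs h1)

theorem limitMean_critical_approx (hs : s ∈ Icc (0.72163 : ℝ) 0.72164)
    (h0 : limitMeanSlope s = 0) : |limitMean s - 0.564| < 0.0005 := by
  -- Criticality replaces e^(1-s)/2 by e - e^s.
  have h : limitMean s = exp 1 * s + exp 1 - 2 * exp s := by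
    unfold limitMean
    unfold limitMeanSlope at h0
    linarith
  obtain ⟨h1, h2⟩ := exp_critical_mem hs
  obtain ⟨h3, h4⟩ := hs
  have h5 := exp_one_gt_d9
  have h6 := exp_one_lt_d9
  rw [h, abs_lt]
  constructor <;> nlinarith

end CriticalPoint

theorem limitMeanSlope_lt_one (b : ℝ) : limitMeanSlope b < 1 := by
  refine lt_of_mul_lt_mul_left ?_ (exp_pos b).le
  rw [exp_mul_limitMeanSlope]
  -- Completed square for x² - (e - 1) x + e/2 > 0, whose discriminant (e - 1)² - 2e is negative.
  nlinarith [sq_nonneg (2 * exp b - exp 1 + 1), exp_one_gt_d9, exp_one_lt_d9]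

theorem strictAnti_limitMean_sub_id : StrictAnti fun b => limitMean b - b := by
  refine strictAnti_of_deriv_neg fun b => ?_
  have h : HasDerivAt (fun b => limitMean b - b) (limitMeanSlope b - 1) b :=
    (hasDerivAt_limitMean b).sub (hasDerivAt_id' b)
  rw [h.deriv]
  exact sub_neg.2 (limitMeanSlope_lt_one b)

theorem exists_limitMean_eq_self : ∃ b ∈ Icc (0.5446 : ℝ) 0.5454, limitMean b = b := by
  have h1 : 0 ≤ limitMean 0.5446 - 0.5446 := by
    refine nonneg_of_mul_nonneg_right ?_ (exp_pos 0.5446)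
    rw [mul_sub, exp_mul_limitMean]
    obtain ⟨hl, hu⟩ := exp_lower_fixed
    nlinarith [exp_one_gt_d9, exp_one_lt_d9]
  have h2 : limitMean 0.5454 - 0.5454 ≤ 0 := by
    refine nonpos_of_mul_nonpos_right ?_ (exp_pos 0.5454)
    rw [mul_sub, exp_mul_limitMean]
    obtain ⟨hl, hu⟩ := exp_upper_fixed
    nlinarith [exp_one_gt_d9, exp_one_lt_d9]
  obtain ⟨b, hb, h⟩ := intermediate_value_Icc' (by norm_num)
    (continuous_limitMean.sub continuous_id).continuousOn ⟨h2, h1⟩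
  exact ⟨b, hb, sub_eq_zero.1 h⟩

theorem integral_limitMean : (∫ b in (0 : ℝ)..1, limitMean b) = 1 / 2 := by
  have h : ∀ b ∈ uIcc (0 : ℝ) 1,
      HasDerivAt (fun b => exp 1 * b ^ 2 / 2 - 1 / 2 * exp (1 - b) - exp b) (limitMean b) b := by
    intro b _
    have h1 := ((hasDerivAt_pow 2 b).const_mul (exp 1)).div_const 2
    have h2 := (((hasDerivAt_id b).const_sub 1).exp).const_mul (1 / 2 : ℝ)
    refine ((h1.sub h2).sub (hasDerivAt_exp b)).congr_deriv ?_
    simp [limitMean]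
    ring
  rw [intervalIntegral.integral_eq_sub_of_hasDerivAt h
    (continuous_limitMean.intervalIntegrable _ _)]
  norm_num
  ring

end CardCyclic

theorem corollary2 :
    ∃ E : ℝ → ℝ,
      -- the limit exists and is given by the formula
      (∀ b ∈ Icc (0 : ℝ) 1, CardCyclic.IsLimitingMean b (E b) ∧
        E b = Real.exp 1 * b + 1 / 2 * Real.exp (1 - b) - Real.exp b) ∧
      (E 0 = 1 / 2 * Real.exp 1 - 1 ∧ |E 0 - 0.359| < 0.0005) ∧
      E 1 = 1 / 2 ∧
      (∃ bs ∈ Ioo (0 : ℝ) 1,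
        |bs - 0.722| < 0.0005 ∧
        (∀ b ∈ Icc (0 : ℝ) 1,
          Real.exp 1 - Real.exp b - 1 / 2 * Real.exp (1 - b) = 0 ↔ b = bs) ∧
        StrictMonoOn E (Icc 0 bs) ∧ StrictAntiOn E (Icc bs 1) ∧
        (∀ b ∈ Icc (0 : ℝ) 1, b ≠ bs → E b < E bs) ∧
        |E bs - 0.564| < 0.0005) ∧
      (∃ bb ∈ Ioo (0 : ℝ) 1,
        |bb - 0.545| < 0.0005 ∧
        (∀ b ∈ Ico (0 : ℝ) bb, b < E b) ∧ E bb = bb ∧ (∀ b ∈ Ioc bb 1, E b < b)) ∧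
      (∫ b in (0 : ℝ)..1, E b) = 1 / 2 := by
  obtain ⟨s, hs, h0⟩ := CardCyclic.exists_limitMeanSlope_eq_zero
  obtain ⟨f, hf, hff⟩ := CardCyclic.exists_limitMean_eq_self
  have hs0 : 0 ≤ s := by linarith [hs.1]
  have hs1 : s ≤ 1 := by linarith [hs.2]
  have hmono := CardCyclic.strictMonoOn_limitMean hs h0
  have hanti := CardCyclic.strictAntiOn_limitMean hs h0
  have hE0 : CardCyclic.limitMean 0 = 1 / 2 * Real.exp 1 - 1 := by simp [CardCyclic.limitMean]
  refine ⟨CardCyclic.limitMean, fun b _ => ⟨CardCyclic.isLimitingMean b, rfl⟩, ⟨hE0, ?_⟩, ?_,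
    ⟨s, ⟨by linarith [hs.1], by linarith [hs.2]⟩, ?_, fun b hb =>
      CardCyclic.limitMeanSlope_eq_zero_iff hs h0 hb.1, hmono, hanti, fun b hb hne => ?_,
      CardCyclic.limitMean_critical_approx hs h0⟩,
    ⟨f, ⟨by linarith [hf.1], by linarith [hf.2]⟩, ?_, fun b hb => ?_, hff, fun b hb => ?_⟩,
    CardCyclic.integral_limitMean⟩
  · rw [hE0, abs_lt]
    constructor <;> linarith [Real.exp_one_gt_d9, Real.exp_one_lt_d9]
  · norm_num [CardCyclic.limitMean]
  · rw [abs_lt]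
    constructor <;> linarith [hs.1, hs.2]
  · rcases hne.lt_or_gt with h | h
    · exact hmono ⟨hb.1, h.le⟩ ⟨hs0, le_rfl⟩ h
    · exact hanti ⟨le_rfl, hs1⟩ ⟨h.le, hb.2⟩ h
  · rw [abs_lt]
    constructor <;> linarith [hf.1, hf.2]
  · have := CardCyclic.strictAnti_limitMean_sub_id hb.2
    simp only at this
    linarith
  · have := CardCyclic.strictAnti_limitMean_sub_id hb.1
    simp only at this
    linarith
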